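/- Let $n\ge 0$ be an integer and let $\xi=(\xi_{ij})$ be a real $n\times n$ matrix with nonnegative entries and zero diagonal. Let $\rho=\|\xi\|_{\mathrm{op}}$ be its spectral norm, i.e. its operator norm on $\mathbb R^n$ with the Euclidean norm. Let $X=(X^1,\dots,X^n)$ be a weak solution with continuous paths of $$dX^i_t=\sum_{j\ne i}\xi_{ij}X^j_t\,dt+dB^i_t,\qquad X^i_0=0,\qquad i=1,\dots,n,$$ where $B^1,\dots,B^n$ are independent one-dimensional standard Brownian motions. Let $Y=(Y^1,\dots,Y^n)$, possibly on another probability space and driven by other independent standard Brownian motions $\tilde B^1,\dots,\tilde B^n$, be a weak solution with continuous paths of the McKean–Vlasov system (the independent projection) $$dY^i_t=\sum_{j\ne i}\xi_{ij}\,\mathbb E[Y^j_t]\,dt+d\tilde B^i_t,\qquad Y^i_0=0,\qquad i=1,\dots,n.$$ For $v\subset\{1,\dots,n\}$ and $t\ge 0$ let $P^v_t$ and $Q^v_t$ be the laws of $(X^i_t)_{i\in v}$ and $(Y^i_t)_{i\in v}$, and let $$H_t(v)=H(P^v_t\,|\,Q^v_t)=\int \frac{dP^v_t}{dQ^v_t}\log\frac{dP^v_t}{dQ^v_t}\,dQ^v_t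 \in[0,\infty]$$ be the relative entropy (equal to $\infty$ if $P^v_t\not\ll Q^v_t$). Then for every $T\ge 0$ with $T\le \frac{\log 2}{2\rho}$ (every $T\ge0$ if $\rho=0$), $$H_T(v)\ \ge\ \frac{T^2}{12}\sum_{i,j\in v}\xi_{ij}^2\qquad\text{for all } v\subset\{1,\dots,n\}.$$ -/

import Mathlib

open MeasureTheory ProbabilityTheory
open scoped NNReal ENNReal

/-- `B = (B 1, …, B n)` is a family of independent standard one-dimensional Brownian motions
under `P`. -/
structure IsBrownianFamily {n : ℕ} {Ω : Type*} [MeasurableSpace Ω]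
    (B : Fin n → ℝ≥0 → Ω → ℝ) (P : Measure Ω) : Prop where
  brownian : ∀ i, IsBrownianReal (B i) P
  indep : iIndepFun (fun (i : Fin n) (ω : Ω) (t : ℝ≥0) => B i t ω) P

/-- `X`, driven by the Brownian motions `B`, is a (weak) solution of the linear particle system
`dXⁱ_t = ∑_{j ≠ i} ξ_{ij} Xʲ_t dt + dBⁱ_t`, `Xⁱ_0 = 0`.
The noise is additive with constant coefficient, so the equation is the pathwise integral equation
below; it is required almost surely, simultaneously for all coordinates and all times. -/
structure IsLinearParticleSystem {n : ℕ} (ξ : Matrix (Fin n) (Fin n) ℝ) {Ω : Type*}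
    [MeasurableSpace Ω] (X B : Fin n → ℝ≥0 → Ω → ℝ) (P : Measure Ω) : Prop where
  noise : IsBrownianFamily B P
  aemeasurable : ∀ i t, AEMeasurable (X i t) P
  continuous_paths : ∀ᵐ ω ∂P, ∀ i, Continuous (fun t => X i t ω)
  init : ∀ᵐ ω ∂P, ∀ i, X i 0 ω = 0
  equation : ∀ᵐ ω ∂P, ∀ i, ∀ t : ℝ≥0,
    X i t ω = X i 0 ω
      + (∫ s in (0 : ℝ)..t, ∑ j ∈ Finset.univ.erase i, ξ i j * X j s.toNNReal ω)
      + B i t ω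

/-- `Y`, driven by the Brownian motions `B`, is a (weak) solution of the independent projection of
the linear particle system, the McKean–Vlasov equation
`dYⁱ_t = ∑_{j ≠ i} ξ_{ij} 𝔼[Yʲ_t] dt + dBⁱ_t`, `Yⁱ_0 = 0`.
The fields `integrable` and `drift_integrable` say that the expectations and the time integral of
the drift are meaningful. -/
structure IsIndependentProjection {n : ℕ} (ξ : Matrix (Fin n) (Fin n) ℝ) {Ω : Type*}
    [MeasurableSpace Ω] (Y B : Fin n → ℝ≥0 → Ω → ℝ) (P : Measure Ω) : Prop where
  noise : IsBrownianFamily B P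
  integrable : ∀ i t, Integrable (Y i t) P
  drift_integrable : ∀ i, ∀ t : ℝ≥0, IntervalIntegrable
    (fun s : ℝ => ∑ j ∈ Finset.univ.erase i, ξ i j * ∫ ω, Y j s.toNNReal ω ∂P) volume 0 t
  continuous_paths : ∀ᵐ ω ∂P, ∀ i, Continuous (fun t => Y i t ω)
  init : ∀ᵐ ω ∂P, ∀ i, Y i 0 ω = 0
  equation : ∀ᵐ ω ∂P, ∀ i, ∀ t : ℝ≥0,
    Y i t ω = Y i 0 ω
      + (∫ s in (0 : ℝ)..t, ∑ j ∈ Finset.univ.erase i, ξ i j * ∫ ω', Y j s.toNNReal ω' ∂P)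
      + B i t ω

/-- The law under `P` of the coordinates `(Xⁱ_t)_{i ∈ v}` at time `t`. -/
noncomputable def marginalLaw {n : ℕ} {Ω : Type*} [MeasurableSpace Ω] (P : Measure Ω)
    (X : Fin n → ℝ≥0 → Ω → ℝ) (v : Finset (Fin n)) (t : ℝ≥0) : Measure (v → ℝ) :=
  P.map (fun ω (i : v) => X i t ω)

/-- The spectral norm of a real square matrix: its operator norm on Euclidean space. -/
noncomputable def spectralNorm₂ {n : ℕ} (ξ : Matrix (Fin n) (Fin n) ℝ) : ℝ :=
  ‖Matrix.toEuclideanCLM (𝕜 := ℝ) ξ‖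

/-!
The independent projection starts at zero and its means solve a linear ODE, so they vanish. Thus `Y`
is its driving Brownian motion, and `Q = Q^v_T` is the isotropic Gaussian `N(0, T)` on `ℝ^v`
(`IsIndependentProjection.marginalLaw_eq`).

The particle system is `X_T = ∫₀ᵀ e^{(T-s)ξ} dB_s`, so its second moments are the entries of
`C = ∫₀ᵀ e^{rξ} (e^{rξ})ᵀ dr` (`IsLinearParticleSystem.secondMoment_eq_gramian`). Let
`M = C / T - 1`, restricted to the coordinates in `v`. For `2ρT ≤ log 2`, convexity gives
`‖e^{rξ}‖² ≤ e^{2rρ} ≤ 1 + r / T`, so that all eigenvalues of `M` are at most `1 / 2`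
(`sum_mul_gramian_le`). Since `ξ` is entrywise nonnegative, `e^{rξ} ≥ 1 + rξ` entrywise, hence
`M_{ij} ≥ (T / 2) (ξ_{ij} + ξ_{ji})` off the diagonal (`le_gramian`).

The entropy is bounded below by testing the Donsker–Varadhan formula
`H(P | Q) ≥ ∫ f dP - log ∫ e^f dQ` on a quadratic form `f` which is diagonal in the eigenvector
basis of `M`. Only the second moments of `P` enter, and `∫ e^f dQ` is an explicit product. With the
coefficient `λ / (3T)` along an eigenvector of eigenvalue `λ ≤ 1 / 2`, each direction contributes
at least `λ² / 6` (`sq_div_three_le`). Therefore `H(P | Q) ≥ ‖M‖²_F / 6`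
(`le_klDiv_pi_gaussianReal_of_secondMoment`), and `‖M‖²_F ≥ (T² / 2) ∑ ξ_{ij}²`.
-/

/-! ### Relative entropy and Gaussian exponential moments -/

/-- The easy half of the Donsker–Varadhan variational formula: when the right side is finite, the
difference between the two sides, before truncation by `ENNReal.ofReal`, is the divergence of `μ`
from the exponentially tilted measure `ν.tilted f`. -/
theorem ofReal_integral_sub_log_integral_exp_le_klDiv {α : Type*} [MeasurableSpace α]
    {μ ν : Measure α} [IsProbabilityMeasure μ] [IsProbabilityMeasure ν] {f : α → ℝ}
    (hf : Integrable f μ) (hexp : Integrable (fun x => Real.exp (f x)) ν) :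
    ENNReal.ofReal (∫ x, f x ∂μ - Real.log (∫ x, Real.exp (f x) ∂ν))
      ≤ InformationTheory.klDiv μ ν := by
  by_cases h : InformationTheory.klDiv μ ν = ∞
  · simp [h]
  obtain ⟨hac, hint⟩ := InformationTheory.klDiv_ne_top_iff.mp h
  have := isProbabilityMeasure_tilted hexp
  have hac' : μ ≪ ν.tilted f := hac.trans (absolutelyContinuous_tilted hexp)
  have h1 := InformationTheory.integral_llr_add_sub_measure_univ_nonneg hac'
    (integrable_llr_tilted_right hac hf hint hexp)
  rw [integral_llr_tilted_right hac hf hexp hint] at h1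
  rw [InformationTheory.klDiv_of_ac_of_integrable hac hint]
  apply ENNReal.ofReal_le_ofReal
  simp at h1 ⊢
  linarith

theorem integrable_exp_mul_sq_gaussianReal {a : ℝ} (ha : 2 * a < 1) :
    Integrable (fun z : ℝ => Real.exp (a * z ^ 2)) (gaussianReal 0 1) := by
  rw [gaussianReal_of_var_ne_zero _ one_ne_zero,
    integrable_withDensity_iff (measurable_gaussianPDF 0 1)
      (.of_forall fun _ => gaussianPDF_lt_top)]
  have h := (integrable_exp_neg_mul_sq (show 0 < 1 / 2 - a by linarith)).mul_const
    ((√(2 * Real.pi))⁻¹)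
  refine h.congr (.of_forall fun z => ?_)
  simp only [toReal_gaussianPDF, gaussianPDFReal_def, NNReal.coe_one, mul_one, sub_zero]
  rw [mul_left_comm, ← Real.exp_add, mul_comm]
  ring_nf

theorem integral_exp_mul_sq_gaussianReal {a : ℝ} (ha : 2 * a < 1) :
    ∫ z, Real.exp (a * z ^ 2) ∂(gaussianReal 0 1) = (√(1 - 2 * a))⁻¹ := by
  rw [integral_gaussianReal_eq_integral_smul one_ne_zero]
  have h : ∀ z : ℝ, gaussianPDFReal 0 1 z • Real.exp (a * z ^ 2)
      = (√(2 * Real.pi))⁻¹ * Real.exp (-(1 / 2 - a) * z ^ 2) := fun z => by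
    simp only [gaussianPDFReal_def, NNReal.coe_one, mul_one, sub_zero, smul_eq_mul]
    rw [mul_assoc, ← Real.exp_add]
    ring_nf
  simp_rw [h]
  rw [integral_const_mul, integral_gaussian, ← Real.sqrt_inv, ← Real.sqrt_inv,
    ← Real.sqrt_mul (by positivity)]
  congr 1
  have h1 : 1 - 2 * a ≠ 0 := by linarith
  have h2 : 1 / 2 - a ≠ 0 := by linarith
  have := Real.pi_ne_zero
  field_simp

/-- The right side exceeds the left side by a function vanishing at `0` whose derivative is
`2 l (1 - 2 l) / (9 - 6 l)`; this is where the bound `1 / 2` on the eigenvalues is needed. -/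
theorem sq_div_three_le {l : ℝ} (hl : l ≤ 1 / 2) :
    l ^ 2 / 3 ≤ 2 / 3 * l + 2 / 3 * l ^ 2 + Real.log (1 - 2 / 3 * l) := by
  let g : ℝ → ℝ := fun l => 2 / 3 * l + l ^ 2 / 3 + Real.log (1 - 2 / 3 * l)
  have hd : ∀ x : ℝ, x ≤ 1 / 2 →
      HasDerivAt g (2 / 3 + 2 / 3 * x + (-(2 / 3)) / (1 - 2 / 3 * x)) x := fun x hx => by
    have h0 : (1 : ℝ) - 2 / 3 * x ≠ 0 := by linarith
    have h1 : HasDerivAt (fun y : ℝ => 1 - 2 / 3 * y) (-(2 / 3)) x := by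
      simpa using ((hasDerivAt_id x).const_mul (2 / 3 : ℝ)).const_sub 1
    have h2 := (((hasDerivAt_id x).const_mul (2 / 3 : ℝ)).add
      (((hasDerivAt_id x).pow 2).div_const 3)).add (h1.log h0)
    refine h2.congr_deriv ?_
    simp; ring
  have hder : ∀ x : ℝ, x ≤ 1 / 2 →
      2 / 3 + 2 / 3 * x + (-(2 / 3)) / (1 - 2 / 3 * x) = 2 * x * (1 - 2 * x) / (9 - 6 * x) := by
    intro x hx
    have h0 : (3 : ℝ) - 2 * x ≠ 0 := by linarith
    rw [show (1 : ℝ) - 2 / 3 * x = (3 - 2 * x) / 3 by ring,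
      show (9 : ℝ) - 6 * x = 3 * (3 - 2 * x) by ring]
    field_simp
    ring
  have g0 : g 0 = 0 := by simp [g]
  suffices h : g 0 ≤ g l by rw [g0] at h; simp only [g] at h; linarith
  rcases le_total 0 l with h | h
  · refine monotoneOn_of_deriv_nonneg (convex_Icc 0 (1 / 2))
      (fun x hx => (hd x hx.2).continuousAt.continuousWithinAt)
      (fun x hx => ?_) (fun x hx => ?_) ⟨le_rfl, by norm_num⟩ ⟨h, hl⟩ h
    · rw [interior_Icc] at hx
      exact (hd x hx.2.le).differentiableAt.differentiableWithinAt
    · rw [interior_Icc] at hx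
      rw [(hd x hx.2.le).deriv, hder x hx.2.le]
      have h1 : 0 ≤ 1 - 2 * x := by linarith [hx.2]
      have h2 : 0 ≤ 9 - 6 * x := by linarith [hx.2]
      have := hx.1.le
      positivity
  · refine antitoneOn_of_deriv_nonpos (convex_Iic 0)
      (fun x hx => (hd x (hx.out.trans (by norm_num))).continuousAt.continuousWithinAt)
      (fun x hx => ?_) (fun x hx => ?_) h (Set.mem_Iic.2 le_rfl) h
    · rw [interior_Iic] at hx
      exact (hd x (hx.out.le.trans (by norm_num))).differentiableAt.differentiableWithinAt
    · rw [interior_Iic] at hx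
      have hx' : x < 0 := hx
      rw [(hd x (by linarith)).deriv, hder x (by linarith)]
      have h1 : 0 ≤ 1 - 2 * x := by linarith
      have h2 : 0 ≤ 9 - 6 * x := by linarith
      exact div_nonpos_of_nonpos_of_nonneg
        (mul_nonpos_of_nonpos_of_nonneg (by linarith) h1) h2

/-- The exponential moment of a quadratic form, diagonal in the orthonormal basis `b`, under a
centred isotropic Gaussian. By rotation invariance the coordinates along `b` are again independent
Gaussians. -/
theorem integrable_and_integral_exp_sum_mul_inner_sq {ι : Type*} [Fintype ι] (T : ℝ≥0)
    (b : OrthonormalBasis ι ℝ (EuclideanSpace ℝ ι)) {c : ι → ℝ} (hc : ∀ k, 2 * (c k * T) < 1) :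
    Integrable (fun x : ι → ℝ => Real.exp (∑ k, c k * (∑ i, b k i * x i) ^ 2))
        (Measure.pi fun _ => gaussianReal 0 T) ∧
      ∫ x : ι → ℝ, Real.exp (∑ k, c k * (∑ i, b k i * x i) ^ 2)
        ∂(Measure.pi fun _ => gaussianReal 0 T) = ∏ k, (√(1 - 2 * (c k * T)))⁻¹ := by
  classical
  let γ : Measure (ι → ℝ) := Measure.pi fun _ => gaussianReal 0 1
  let F : (ι → ℝ) → ℝ := fun x => Real.exp (∑ k, c k * (∑ i, b k i * x i) ^ 2)
  let F' : EuclideanSpace ℝ ι → ℝ := fun y => Real.exp (∑ k, c k * T * inner ℝ (b k) y ^ 2)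
  have hscale : (Measure.pi fun _ : ι => gaussianReal 0 T) = γ.map (fun x i => √(T : ℝ) * x i) := by
    have h := Measure.pi_map_pi (μ := fun _ : ι => gaussianReal 0 1)
      (f := fun _ : ι => fun z : ℝ => √(T : ℝ) * z) (fun i => by fun_prop)
    rw [h]
    congr 1
    ext1 i
    rw [gaussianReal_map_const_mul]
    congr 1
    · simp
    · ext; simp
  -- After rescaling, both sides are integrals against the rotation invariant `stdGaussian`.
  have hFF' : ∀ x : ι → ℝ, F (fun i => √(T : ℝ) * x i) = F' (WithLp.toLp 2 x) := fun x => by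
    simp only [F, F', PiLp.inner_apply]
    congr 1
    refine Finset.sum_congr rfl fun k _ => ?_
    have h : ∑ i, b k i * (√(T : ℝ) * x i) = √(T : ℝ) * ∑ i, b k i * x i := by
      rw [Finset.mul_sum]; exact Finset.sum_congr rfl fun i _ => by ring
    rw [h, mul_pow, Real.sq_sqrt T.coe_nonneg, ← mul_assoc]
    simp [mul_comm]
  have hF'm : Measurable F' := by fun_prop
  have hF'' : ∀ x : ι → ℝ, F' (∑ i, x i • b i) = ∏ k, Real.exp (c k * T * x k ^ 2) := fun x => by
    simp only [F']
    rw [Real.exp_sum]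
    refine Finset.prod_congr rfl fun k _ => ?_
    simp [inner_sum, inner_smul_right, b.inner_eq_ite]
  have hstd := map_pi_eq_stdGaussian (ι := ι)
  rw [stdGaussian_eq_map_pi_orthonormalBasis b] at hstd
  have m1 : Measurable (fun x : ι → ℝ => WithLp.toLp 2 x) := by fun_prop
  have m2 : Measurable (fun x : ι → ℝ => ∑ i, x i • b i) := by fun_prop
  have hint : Integrable F' (γ.map (fun x => ∑ i, x i • b i)) := by
    rw [integrable_map_measure hF'm.aestronglyMeasurable m2.aemeasurable]
    simp only [Function.comp_def, hF'']
    exact Integrable.fintype_prod fun k => integrable_exp_mul_sq_gaussianReal (hc k)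
  have mS : Measurable (fun (x : ι → ℝ) i => √(T : ℝ) * x i) := by fun_prop
  have mF : Measurable F := by fun_prop
  refine ⟨?_, ?_⟩
  · change Integrable F _
    rw [hscale, integrable_map_measure mF.aestronglyMeasurable mS.aemeasurable]
    simp only [Function.comp_def, hFF']
    rw [← hstd, integrable_map_measure hF'm.aestronglyMeasurable m1.aemeasurable] at hint
    exact hint
  · change ∫ x, F x ∂_ = _
    rw [hscale, integral_map mS.aemeasurable mF.aestronglyMeasurable]
    simp only [hFF']
    rw [← integral_map (φ := fun x : ι → ℝ => WithLp.toLp 2 x) (f := F') m1.aemeasurable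
      hF'm.aestronglyMeasurable, hstd, integral_map m2.aemeasurable hF'm.aestronglyMeasurable]
    simp only [hF'']
    rw [integral_fintype_prod_eq_prod (f := fun k z => Real.exp (c k * T * z ^ 2))]
    exact Finset.prod_congr rfl fun k _ => integral_exp_mul_sq_gaussianReal (hc k)

/-! ### An entropy bound from second moments -/

/-- The Frobenius norm of a symmetric matrix in terms of its eigenvalues, by Parseval's identity
applied to each row in the eigenvector basis. -/
theorem Matrix.IsHermitian.sum_eigenvalues_sq {ι : Type*} [Fintype ι] [DecidableEq ι]
    {M : Matrix ι ι ℝ} (hM : M.IsHermitian) :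
    ∑ k, hM.eigenvalues k ^ 2 = ∑ i, ∑ j, M i j ^ 2 := by
  let u := hM.eigenvectorBasis
  have h1 : ∀ k, hM.eigenvalues k ^ 2 = ∑ i, (∑ j, M i j * u k j) ^ 2 := fun k => by
    have h := hM.mulVec_eigenvectorBasis k
    have hi : ∀ i, ∑ j, M i j * u k j = hM.eigenvalues k * u k i := fun i => congrFun h i
    simp_rw [hi, mul_pow, ← Finset.mul_sum]
    have := EuclideanSpace.real_norm_sq_eq (u k)
    rw [u.orthonormal.1 k] at this
    rw [← this]; simp
  have h2 : ∀ i, ∑ j, M i j ^ 2 = ∑ k, (∑ j, M i j * u k j) ^ 2 := fun i => by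
    have h := u.sum_sq_inner_right (WithLp.toLp 2 (M i))
    rw [EuclideanSpace.real_norm_sq_eq] at h
    simpa [PiLp.inner_apply] using h.symm
  simp_rw [h1, h2]
  exact Finset.sum_comm

theorem sq_sum_mul_eq {ι : Type*} [Fintype ι] (w x : ι → ℝ) :
    (∑ i, w i * x i) ^ 2 = ∑ i, ∑ j, w i * w j * (x i * x j) := by
  rw [sq, Finset.sum_mul_sum]
  exact Finset.sum_congr rfl fun i _ => Finset.sum_congr rfl fun j _ => by ring

/-- Entropy bound from second moments alone, whatever the law `μ`. If `C` is the second
moment matrix of `μ` and `C ≤ (3/2) T` as quadratic forms, then the divergence of `μ` from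
`N(0, T)^ι` is at least one sixth of the squared Frobenius norm of `C / T - 1`. -/
theorem le_klDiv_pi_gaussianReal_of_secondMoment {ι : Type*} [Fintype ι] [DecidableEq ι]
    {μ : Measure (ι → ℝ)} [IsProbabilityMeasure μ] {T : ℝ≥0} (hT : 0 < T) {C : Matrix ι ι ℝ}
    (hint : ∀ i j, Integrable (fun x : ι → ℝ => x i * x j) μ)
    (hC : ∀ i j, ∫ x, x i * x j ∂μ = C i j)
    (hle : ∀ w : ι → ℝ, ∑ i, ∑ j, w i * w j * C i j ≤ 3 / 2 * T * ∑ i, w i ^ 2) :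
    ENNReal.ofReal (1 / 6 * ∑ i, ∑ j, (C i j / T - (1 : Matrix ι ι ℝ) i j) ^ 2)
      ≤ InformationTheory.klDiv μ (Measure.pi fun _ => gaussianReal 0 T) := by
  have hT' : (0 : ℝ) < T := hT
  let M : Matrix ι ι ℝ := Matrix.of fun i j => C i j / T - (1 : Matrix ι ι ℝ) i j
  have hM : M.IsHermitian := by
    ext i j
    simp only [M, Matrix.conjTranspose_apply, Matrix.of_apply, star_trivial, ← hC,
      Matrix.one_apply, eq_comm (a := j), mul_comm]
  let u := hM.eigenvectorBasis
  let l := hM.eigenvalues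
  have hu : ∀ k, ∑ i, u k i ^ 2 = 1 := fun k => by
    rw [← EuclideanSpace.real_norm_sq_eq, u.orthonormal.1 k, one_pow]
  have hl : ∀ k, ∑ i, ∑ j, u k i * u k j * C i j = T * (1 + l k) := fun k => by
    have h := hM.mulVec_eigenvectorBasis k
    have hi : ∀ i, ∑ j, C i j * u k j = T * (1 + l k) * u k i := fun i => by
      have h1 : ∑ j, M i j * u k j = l k * u k i := congrFun h i
      simp only [M, Matrix.of_apply, sub_mul, Finset.sum_sub_distrib, Matrix.one_apply, ite_mul,
        one_mul, zero_mul, Finset.sum_ite_eq, Finset.mem_univ, if_true, div_mul_eq_mul_div,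
        ← Finset.sum_div] at h1
      rw [sub_eq_iff_eq_add, div_eq_iff hT'.ne'] at h1
      rw [h1]; ring
    calc ∑ i, ∑ j, u k i * u k j * C i j = ∑ i, u k i * ∑ j, C i j * u k j := by
          simp_rw [Finset.mul_sum]
          exact Finset.sum_congr rfl fun i _ => Finset.sum_congr rfl fun j _ => by ring
      _ = T * (1 + l k) * ∑ i, u k i ^ 2 := by
          simp_rw [hi, Finset.mul_sum]
          exact Finset.sum_congr rfl fun i _ => by ring
      _ = T * (1 + l k) := by rw [hu, mul_one]
  have hl_le : ∀ k, l k ≤ 1 / 2 := fun k => by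
    have h := hle (u k)
    rw [hl, hu] at h
    have : (T : ℝ) * (1 + l k) ≤ T * (3 / 2) := by linarith
    linarith [le_of_mul_le_mul_left this hT']
  -- The exact optimizer for Gaussian `μ` is `l k / (2 * T * (1 + l k))`. The choice below needs no
  -- inverse of `1 + l k` and still yields the constant `1 / 6`.
  let c : ι → ℝ := fun k => l k / (3 * T)
  have hcT : ∀ k, c k * T = l k / 3 := fun k => by simp only [c]; field_simp
  obtain ⟨hexp, hexp_eq⟩ := integrable_and_integral_exp_sum_mul_inner_sq T u (c := c)
    (fun k => by rw [hcT]; linarith [hl_le k])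
  have hsq : ∀ k, Integrable (fun x : ι → ℝ => (∑ i, u k i * x i) ^ 2) μ := fun k => by
    simp_rw [sq_sum_mul_eq]
    exact integrable_finsetSum _ fun i _ => integrable_finsetSum _ fun j _ =>
      (hint i j).const_mul _
  have hsq_eq : ∀ k, ∫ x : ι → ℝ, (∑ i, u k i * x i) ^ 2 ∂μ = T * (1 + l k) := fun k => by
    simp_rw [sq_sum_mul_eq]
    rw [integral_finsetSum _ fun i _ => integrable_finsetSum _ fun j _ => (hint i j).const_mul _,
      ← hl]
    refine Finset.sum_congr rfl fun i _ => ?_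
    rw [integral_finsetSum _ fun j _ => (hint i j).const_mul _]
    exact Finset.sum_congr rfl fun j _ => by rw [integral_const_mul, hC]
  refine le_trans (ENNReal.ofReal_le_ofReal ?_)
    (ofReal_integral_sub_log_integral_exp_le_klDiv
      (integrable_finsetSum _ fun k _ => (hsq k).const_mul (c k)) hexp)
  have hlog : Real.log (∏ k, (√(1 - 2 * (c k * T)))⁻¹)
      = ∑ k, -(Real.log (1 - 2 / 3 * l k) / 2) := by
    have h0 : ∀ k, 0 < 1 - 2 / 3 * l k := fun k => by linarith [hl_le k]
    have h1 : ∀ k, 1 - 2 * (c k * T) = 1 - 2 / 3 * l k := fun k => by rw [hcT]; ring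
    simp_rw [h1]
    rw [Real.log_prod fun k _ => inv_ne_zero (Real.sqrt_pos.2 (h0 k)).ne']
    exact Finset.sum_congr rfl fun k _ => by rw [Real.log_inv, Real.log_sqrt (h0 k).le]
  rw [hexp_eq, hlog, integral_finsetSum _ fun k _ => (hsq k).const_mul (c k),
    ← Finset.sum_sub_distrib]
  change 1 / 6 * ∑ i, ∑ j, M i j ^ 2 ≤ _
  rw [← hM.sum_eigenvalues_sq, Finset.mul_sum]
  refine Finset.sum_le_sum fun k _ => ?_
  rw [integral_const_mul, hsq_eq, ← mul_assoc, hcT]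
  have := sq_div_three_le (hl_le k)
  change 1 / 6 * l k ^ 2 ≤ _
  linarith

/-! ### Wiener integrals of smooth functions -/

/-- `W`, indexed by real times, has measurable marginals, continuous paths and the variance function
of a Brownian motion on `[0, ∞)`. What happens at negative times is irrelevant. -/
structure IsContinuousBrownianVersion {Ω : Type*} [MeasurableSpace Ω] (W : ℝ → Ω → ℝ)
    (P : Measure Ω) : Prop where
  measurable : ∀ t, Measurable (W t)
  continuous : ∀ ω, Continuous fun t => W t ω
  memLp : ∀ t, MemLp (W t) 2 P
  integral_sq : ∀ t, 0 ≤ t → ∫ ω, W t ω ^ 2 ∂P = t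

/-- The marginals of `B` are only a.e. measurable, and its paths are continuous only almost surely.
Setting `B` to zero off a measurable set of full measure, on which the paths are continuous and
agree with measurable versions along a countable dense set of times, repairs both defects. It makes
the process jointly measurable, as Fubini's theorem requires. -/
theorem ProbabilityTheory.IsBrownianReal.exists_continuousVersion {Ω : Type*} [MeasurableSpace Ω]
    {B : ℝ≥0 → Ω → ℝ} {P : Measure Ω} (hB : IsBrownianReal B P) :
    ∃ W : ℝ → Ω → ℝ, IsContinuousBrownianVersion W P ∧
      ∀ᵐ ω ∂P, ∀ t, W t ω = B t.toNNReal ω := by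
  classical
  have : IsProbabilityMeasure P := hB.isGaussianProcess.isProbabilityMeasure
  let d := TopologicalSpace.denseSeq ℝ≥0
  have hgood : ∀ᵐ ω ∂P, Continuous (B · ω) ∧ ∀ k, B (d k) ω = (hB.aemeasurable (d k)).mk _ ω :=
    hB.cont.and (ae_all_iff.2 fun k => (hB.aemeasurable (d k)).ae_eq_mk)
  obtain ⟨S, hS, hSm, hS1⟩ := hgood.exists_measurable_mem
  let W : ℝ≥0 → Ω → ℝ := fun t => S.indicator (B t)
  have hWc : ∀ ω, Continuous fun t => W t ω := fun ω => by
    by_cases h : ω ∈ S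
    · simpa [W, h] using (hS1 ω h).1
    · simpa [W, h] using continuous_const
  have hWd : ∀ k, Measurable (W (d k)) := fun k => by
    have h : W (d k) = S.indicator ((hB.aemeasurable (d k)).mk _) :=
      Set.indicator_congr fun ω hω => (hS1 ω hω).2 k
    rw [h]
    exact (hB.aemeasurable (d k)).measurable_mk.indicator hSm
  have hWm : ∀ t, Measurable (W t) := fun t => by
    obtain ⟨x, hx, hxt⟩ := mem_closure_iff_seq_limit.1 (TopologicalSpace.denseRange_denseSeq ℝ≥0 t)
    refine measurable_of_tendsto_metrizable (f := fun k => W (x k)) (fun k => ?_)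
      (tendsto_pi_nhds.2 fun ω => ((hWc ω).tendsto t).comp hxt)
    obtain ⟨m, hm⟩ := hx k
    rw [← hm]
    exact hWd m
  have hWB : ∀ᵐ ω ∂P, ∀ t, W t ω = B t ω := by
    filter_upwards [hS] with ω hω t using Set.indicator_of_mem hω _
  have hWB' : ∀ t, B t =ᵐ[P] W t := fun t => hWB.mono fun ω h => (h t).symm
  have hpre : IsPreBrownianReal W P := hB.toIsPreBrownianReal.congr hWB'
  have hL2 : ∀ t, MemLp (W t) 2 P := fun t =>
    (hpre.isGaussianProcess.hasGaussianLaw_eval t).memLp_two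
  refine ⟨fun t => W t.toNNReal, ⟨fun t => hWm _, fun ω => (hWc ω).comp continuous_real_toNNReal,
    fun t => hL2 _, fun t ht => ?_⟩, hWB.mono fun ω h t => h _⟩
  have h := hpre.covariance_eval t.toNNReal t.toNNReal
  rw [covariance_eq_sub (hL2 _) (hL2 _), hpre.integral_eval, mul_zero, sub_zero, min_self,
    Real.coe_toNNReal t ht] at h
  simpa only [Pi.mul_apply, sq] using h

theorem MeasureTheory.MemLp.integrable_fun_mul {Ω : Type*} [MeasurableSpace Ω] {P : Measure Ω}
    {f g : Ω → ℝ} (hf : MemLp f 2 P) (hg : MemLp g 2 P) : Integrable (fun ω => f ω * g ω) P :=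
  hf.integrable_mul hg

/-- The Cauchy–Schwarz inequality against a constant, by expanding `0 ≤ ∫ (T f - ∫ f)²`. -/
theorem sq_intervalIntegral_le {f : ℝ → ℝ} (hf : Continuous f) {T : ℝ} (hT : 0 ≤ T) :
    (∫ s in 0..T, f s) ^ 2 ≤ T * ∫ s in 0..T, f s ^ 2 := by
  rcases hT.eq_or_lt with rfl | hT
  · simp
  set m := ∫ s in 0..T, f s
  have h : 0 ≤ ∫ s in 0..T, (T * f s - m) ^ 2 :=
    intervalIntegral.integral_nonneg hT.le fun s _ => sq_nonneg _
  have h1 : ∫ s in 0..T, (T * f s - m) ^ 2 = T ^ 2 * (∫ s in 0..T, f s ^ 2) - T * m ^ 2 := by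
    have h2 : ∀ s, (T * f s - m) ^ 2 = T ^ 2 * f s ^ 2 - 2 * T * m * f s + m ^ 2 := fun s => by ring
    simp_rw [h2]
    rw [intervalIntegral.integral_add, intervalIntegral.integral_sub,
      intervalIntegral.integral_const_mul, intervalIntegral.integral_const_mul,
      intervalIntegral.integral_const]
    · simp only [smul_eq_mul, m]; ring
    all_goals exact Continuous.intervalIntegrable (by fun_prop) _ _
  rw [h1] at h
  have : 0 ≤ T * (T * (∫ s in 0..T, f s ^ 2) - m ^ 2) := by linarith
  linarith [nonneg_of_mul_nonneg_right this hT]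

namespace IsContinuousBrownianVersion

variable {Ω : Type*} [MeasurableSpace Ω] {P : Measure Ω} {W : ℝ → Ω → ℝ} {a : ℝ → ℝ} {T : ℝ}

theorem measurable_uncurry (hW : IsContinuousBrownianVersion W P) :
    Measurable (Function.uncurry W) :=
  measurable_uncurry_of_continuous_of_measurable hW.continuous hW.measurable

variable [IsProbabilityMeasure P]

theorem integrable_sq_prod (hW : IsContinuousBrownianVersion W P) (ha : Continuous a) :
    Integrable (fun p : ℝ × Ω => (a p.1 * W p.1 p.2) ^ 2)
      ((volume.restrict (Set.Ioc 0 T)).prod P) := by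
  have hm : Measurable (fun p : ℝ × Ω => (a p.1 * W p.1 p.2) ^ 2) :=
    ((ha.measurable.comp measurable_fst).mul hW.measurable_uncurry).pow_const 2
  rw [integrable_prod_iff hm.aestronglyMeasurable]
  simp only [mul_pow, norm_mul, norm_pow, Real.norm_eq_abs, sq_abs]
  refine ⟨.of_forall fun s => (hW.memLp s).integrable_sq.const_mul _, ?_⟩
  have h : IntegrableOn (fun s => a s ^ 2 * s) (Set.Ioc 0 T) :=
    (Continuous.integrableOn_Icc (by fun_prop)).mono_set Set.Ioc_subset_Icc_self
  refine h.congr_fun_ae ?_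
  refine (ae_restrict_iff' measurableSet_Ioc).2 (.of_forall fun s hs => ?_)
  change _ = ∫ ω, a s ^ 2 * W s ω ^ 2 ∂P
  rw [integral_const_mul, hW.integral_sq s hs.1.le]

theorem memLp_intervalIntegral (hW : IsContinuousBrownianVersion W P) (ha : Continuous a)
    (hT : 0 ≤ T) : MemLp (fun ω => ∫ s in 0..T, a s * W s ω) 2 P := by
  have hm : StronglyMeasurable (fun ω => ∫ s in 0..T, a s * W s ω) := by
    simp only [intervalIntegral.integral_of_le hT]
    exact (((ha.measurable.comp measurable_snd).mul
      (hW.measurable_uncurry.comp measurable_swap)).stronglyMeasurable).integral_prod_right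
  rw [memLp_two_iff_integrable_sq hm.aestronglyMeasurable]
  refine ((hW.integrable_sq_prod (T := T) ha).integral_prod_right.const_mul T).mono'
    (hm.pow 2).aestronglyMeasurable (.of_forall fun ω => ?_)
  rw [Real.norm_eq_abs, abs_of_nonneg (sq_nonneg _), ← intervalIntegral.integral_of_le hT]
  exact sq_intervalIntegral_le (ha.mul (hW.continuous ω)) hT

theorem integral_intervalIntegral_mul (hW : IsContinuousBrownianVersion W P) (ha : Continuous a)
    (hT : 0 ≤ T) {V : Ω → ℝ} (hV : MemLp V 2 P) :
    ∫ ω, (∫ s in 0..T, a s * W s ω) * V ω ∂P = ∫ s in 0..T, a s * ∫ ω, W s ω * V ω ∂P := by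
  simp only [intervalIntegral.integral_of_le hT, ← integral_const_mul, ← integral_mul_const]
  have hm : AEStronglyMeasurable (fun p : ℝ × Ω => a p.1 * W p.1 p.2 * V p.2)
      ((volume.restrict (Set.Ioc 0 T)).prod P) :=
    (((ha.measurable.comp measurable_fst).mul hW.measurable_uncurry).aestronglyMeasurable).mul
      hV.aestronglyMeasurable.comp_snd
  have hV2 : Integrable (fun p : ℝ × Ω => V p.2 ^ 2) ((volume.restrict (Set.Ioc 0 T)).prod P) :=
    hV.integrable_sq.comp_snd _
  have hint : Integrable (fun p : ℝ × Ω => a p.1 * W p.1 p.2 * V p.2)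
      ((volume.restrict (Set.Ioc 0 T)).prod P) := by
    refine ((hW.integrable_sq_prod (T := T) ha).add hV2).mono' hm (.of_forall fun p => ?_)
    rw [Real.norm_eq_abs, abs_mul]
    simp only [Pi.add_apply]
    nlinarith [sq_nonneg (|a p.1 * W p.1 p.2| - |V p.2|), sq_abs (a p.1 * W p.1 p.2),
      sq_abs (V p.2), sq_nonneg (a p.1 * W p.1 p.2), sq_nonneg (V p.2)]
  rw [← integral_integral_swap (f := fun s ω => a s * W s ω * V ω) hint]
  simp only [mul_assoc]

end IsContinuousBrownianVersion

/-- The Wiener integral `∫₀ᵀ h dW` of a continuously differentiable `h` with derivative `h'`,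
defined path by path through integration by parts. -/
noncomputable def wienerIntegral {Ω : Type*} (h h' : ℝ → ℝ) (W : ℝ → Ω → ℝ) (T : ℝ) (ω : Ω) : ℝ :=
  h T * W T ω - ∫ s in 0..T, h' s * W s ω

section

variable {Ω : Type*} [MeasurableSpace Ω] {P : Measure Ω} [IsProbabilityMeasure P]
  {W W' : ℝ → Ω → ℝ} {g g' h h' : ℝ → ℝ} {T c : ℝ}

theorem memLp_wienerIntegral (hW : IsContinuousBrownianVersion W P) (hh' : Continuous h')
    (hT : 0 ≤ T) : MemLp (wienerIntegral h h' W T) 2 P :=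
  ((hW.memLp T).const_mul (h T)).sub (hW.memLp_intervalIntegral hh' hT)

theorem integral_deriv_mul_min (hh : ∀ s, HasDerivAt h (h' s) s) (hh' : Continuous h') {s : ℝ}
    (hs : 0 ≤ s) (hsT : s ≤ T) :
    ∫ u in 0..T, h' u * min s u = h T * s - ∫ u in 0..s, h u := by
  have hc : Continuous h := continuous_iff_continuousAt.2 fun s => (hh s).continuousAt
  rw [← intervalIntegral.integral_add_adjacent_intervals (b := s)
    (Continuous.intervalIntegrable (by fun_prop) _ _)
    (Continuous.intervalIntegrable (by fun_prop) _ _)]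
  have h1 : ∫ u in 0..s, h' u * min s u = ∫ u in 0..s, h' u * u := by
    refine intervalIntegral.integral_congr fun u hu => ?_
    rw [Set.uIcc_of_le hs] at hu
    simp only [min_eq_right hu.2]
  have h2 : ∫ u in s..T, h' u * min s u = ∫ u in s..T, h' u * s := by
    refine intervalIntegral.integral_congr fun u hu => ?_
    rw [Set.uIcc_of_le hsT] at hu
    simp only [min_eq_left hu.1]
  have h3 := intervalIntegral.integral_mul_deriv_eq_deriv_mul (a := 0) (b := s) (u := id)
    (u' := fun _ => 1) (v := h) (v' := h') (fun x _ => hasDerivAt_id x) (fun x _ => hh x)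
    (Continuous.intervalIntegrable (by fun_prop) _ _)
    (Continuous.intervalIntegrable (by fun_prop) _ _)
  simp only [id, zero_mul, sub_zero, one_mul] at h3
  rw [h1, h2, intervalIntegral.integral_mul_const,
    intervalIntegral.integral_eq_sub_of_hasDerivAt (fun x _ => hh x)
      (hh'.intervalIntegrable _ _)]
  simp_rw [mul_comm (h' _)]
  rw [h3]; ring

theorem integral_mul_wienerIntegral (hW : IsContinuousBrownianVersion W P)
    (hW' : IsContinuousBrownianVersion W' P)
    (hcov : ∀ s u, 0 ≤ s → 0 ≤ u → ∫ ω, W s ω * W' u ω ∂P = c * min s u)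
    (hh : ∀ s, HasDerivAt h (h' s) s) (hh' : Continuous h') {s : ℝ}
    (hs : 0 ≤ s) (hsT : s ≤ T) :
    ∫ ω, W s ω * wienerIntegral h h' W' T ω ∂P = c * ∫ u in 0..s, h u := by
  have hT := hs.trans hsT
  simp only [wienerIntegral, mul_sub]
  rw [integral_sub ((hW.memLp s).integrable_fun_mul ((hW'.memLp T).const_mul (h T)))
    ((hW.memLp s).integrable_fun_mul (hW'.memLp_intervalIntegral hh' hT))]
  simp_rw [mul_left_comm _ (h T), mul_comm (W s _) (∫ u in 0..T, _)]
  rw [integral_const_mul, hcov s T hs hT, min_eq_left hsT,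
    hW'.integral_intervalIntegral_mul hh' hT (hW.memLp s)]
  have h1 : ∫ u in 0..T, h' u * ∫ ω, W' u ω * W s ω ∂P = ∫ u in 0..T, c * (h' u * min s u) := by
    refine intervalIntegral.integral_congr fun u hu => ?_
    rw [Set.uIcc_of_le hT] at hu
    simp only [mul_comm (W' u _), hcov s u hs hu.1]
    ring
  rw [h1, intervalIntegral.integral_const_mul, integral_deriv_mul_min hh hh' hs hsT]
  ring

/-- The Wiener isometry. The constant `c` is the correlation of the two noises, so independent
noises (`c = 0`) and a single noise (`c = 1`) are treated together. -/
theorem integral_wienerIntegral_mul_wienerIntegral (hW : IsContinuousBrownianVersion W P)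
    (hW' : IsContinuousBrownianVersion W' P)
    (hcov : ∀ s u, 0 ≤ s → 0 ≤ u → ∫ ω, W s ω * W' u ω ∂P = c * min s u)
    (hg : ∀ s, HasDerivAt g (g' s) s) (hg' : Continuous g')
    (hh : ∀ s, HasDerivAt h (h' s) s) (hh' : Continuous h') (hT : 0 ≤ T) :
    ∫ ω, wienerIntegral g g' W T ω * wienerIntegral h h' W' T ω ∂P
      = c * ∫ s in 0..T, g s * h s := by
  have hV := memLp_wienerIntegral (h := h) hW' hh' hT
  have hc : Continuous h := continuous_iff_continuousAt.2 fun s => (hh s).continuousAt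
  have hE {s : ℝ} := integral_mul_wienerIntegral (s := s) (T := T) hW hW' hcov hh hh'
  rw [show (fun ω => wienerIntegral g g' W T ω * wienerIntegral h h' W' T ω)
    = fun ω => g T * (W T ω * wienerIntegral h h' W' T ω)
      - (∫ s in 0..T, g' s * W s ω) * wienerIntegral h h' W' T ω from
      funext fun ω => by rw [wienerIntegral]; ring]
  rw [integral_sub (((hW.memLp T).integrable_fun_mul hV).const_mul _)
    ((hW.memLp_intervalIntegral hg' hT).integrable_fun_mul hV), integral_const_mul, hE hT le_rfl,
    hW.integral_intervalIntegral_mul hg' hT hV]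
  have h1 : ∫ s in 0..T, g' s * ∫ ω, W s ω * wienerIntegral h h' W' T ω ∂P
      = ∫ s in 0..T, c * (g' s * ∫ u in 0..s, h u) := by
    refine intervalIntegral.integral_congr fun s hs => ?_
    rw [Set.uIcc_of_le hT] at hs
    simp only [hE hs.1 hs.2]
    ring
  rw [h1, intervalIntegral.integral_const_mul]
  have h2 := intervalIntegral.integral_mul_deriv_eq_deriv_mul (a := 0) (b := T) (u := g) (u' := g')
    (v := fun s => ∫ u in 0..s, h u) (v' := h) (fun x _ => hg x)
    (fun x _ => hc.integral_hasStrictDerivAt 0 x |>.hasDerivAt)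
    (hg'.intervalIntegrable _ _) (hc.intervalIntegrable _ _)
  simp only [intervalIntegral.integral_same, mul_zero, sub_zero] at h2
  rw [h2]
  ring

end

/-! ### The matrix exponential of the drift -/

section MatrixExponential

open scoped Matrix.Norms.L2Operator

variable {n : ℕ} {ξ : Matrix (Fin n) (Fin n) ℝ}

/-- The `(i, j)` entry of the propagator `e^{rξ}` of the linear drift. -/
noncomputable def propagator (ξ : Matrix (Fin n) (Fin n) ℝ) (i j : Fin n) (r : ℝ) : ℝ :=
  NormedSpace.exp (r • ξ) i j

theorem propagator_zero (ξ : Matrix (Fin n) (Fin n) ℝ) (i j : Fin n) :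
    propagator ξ i j 0 = (1 : Matrix (Fin n) (Fin n) ℝ) i j := by
  simp [propagator]

theorem hasDerivAt_propagator (ξ : Matrix (Fin n) (Fin n) ℝ) (i j : Fin n) (r : ℝ) :
    HasDerivAt (propagator ξ i j) (∑ k, propagator ξ i k r * ξ k j) r := by
  have h := hasDerivAt_exp_smul_const (𝕂 := ℝ) ξ r
  let L : Matrix (Fin n) (Fin n) ℝ →ₗ[ℝ] ℝ := Matrix.entryLinearMap ℝ ℝ i j
  exact L.toContinuousLinearMap.hasFDerivAt.comp_hasDerivAt r h

@[fun_prop]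
theorem continuous_propagator (ξ : Matrix (Fin n) (Fin n) ℝ) (i j : Fin n) :
    Continuous (propagator ξ i j) :=
  continuous_iff_continuousAt.2 fun r => (hasDerivAt_propagator ξ i j r).continuousAt

theorem hasSum_exp_apply (A : Matrix (Fin n) (Fin n) ℝ) (i j : Fin n) :
    HasSum (fun m : ℕ => (m.factorial : ℝ)⁻¹ * (A ^ m) i j) (NormedSpace.exp A i j) := by
  have h := NormedSpace.exp_series_hasSum_exp' (𝕂 := ℝ) A
  let L : Matrix (Fin n) (Fin n) ℝ →ₗ[ℝ] ℝ := Matrix.entryLinearMap ℝ ℝ i j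
  exact L.toContinuousLinearMap.hasSum h

/-- All terms of the exponential series are entrywise nonnegative, so the exponential dominates its
first two terms. -/
theorem one_add_mul_le_propagator (hξ : ∀ i j, 0 ≤ ξ i j) {r : ℝ} (hr : 0 ≤ r)
    (i j : Fin n) : (1 : Matrix (Fin n) (Fin n) ℝ) i j + r * ξ i j
      ≤ propagator ξ i j r := by
  have hpow : ∀ (m : ℕ) i j, 0 ≤ ((r • ξ) ^ m) i j := fun m => by
    induction m with
    | zero => intro i j; simp only [pow_zero, Matrix.one_apply]; split_ifs <;> simp
    | succ m ih =>
      intro i j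
      rw [pow_succ, Matrix.mul_apply]
      exact Finset.sum_nonneg fun k _ => mul_nonneg (ih i k) (by simpa using mul_nonneg hr (hξ k j))
  have h := sum_le_hasSum (Finset.range 2)
    (fun m _ => mul_nonneg (by positivity) (hpow m i j)) (hasSum_exp_apply (r • ξ) i j)
  simpa [Finset.sum_range_succ, propagator] using h

theorem norm_exp_le_exp_norm_of_normedAlgebra {A : Type*} [NormedRing A] [NormOneClass A]
    [NormedAlgebra ℝ A] [CompleteSpace A] (x : A) : ‖NormedSpace.exp x‖ ≤ Real.exp ‖x‖ := by
  have h1 := NormedSpace.exp_series_hasSum_exp' (𝕂 := ℝ) x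
  have h2 := NormedSpace.exp_series_hasSum_exp' (𝕂 := ℝ) ‖x‖
  rw [← Real.exp_eq_exp_ℝ] at h2
  refine h1.norm_le_of_bounded h2 fun m => ?_
  rw [norm_smul, norm_inv, smul_eq_mul]
  gcongr
  · simp
  · exact norm_pow_le x m

theorem norm_exp_smul_le (ξ : Matrix (Fin n) (Fin n) ℝ) {r : ℝ} (hr : 0 ≤ r) :
    ‖NormedSpace.exp (r • ξ)‖ ≤ Real.exp (r * spectralNorm₂ ξ) := by
  rcases isEmpty_or_nonempty (Fin n) with h | h
  · rw [Subsingleton.elim (NormedSpace.exp (r • ξ)) 0, norm_zero]; positivity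
  · refine (norm_exp_le_exp_norm_of_normedAlgebra _).trans (le_of_eq ?_)
    rw [norm_smul, Real.norm_of_nonneg hr]
    rfl

theorem sum_sq_mul_propagator_le (ξ : Matrix (Fin n) (Fin n) ℝ) {r : ℝ} (hr : 0 ≤ r)
    (w : Fin n → ℝ) : ∑ k, (∑ i, w i * propagator ξ i k r) ^ 2
      ≤ Real.exp (2 * r * spectralNorm₂ ξ) * ∑ i, w i ^ 2 := by
  set G := NormedSpace.exp (r • ξ)
  have h := Matrix.l2_opNorm_mulVec (Matrix.conjTranspose G) (WithLp.toLp 2 w)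
  rw [Matrix.l2_opNorm_conjTranspose] at h
  have h2 := pow_le_pow_left₀ (norm_nonneg _)
    (h.trans (mul_le_mul_of_nonneg_right (norm_exp_smul_le ξ hr) (norm_nonneg _))) 2
  rw [mul_pow, EuclideanSpace.real_norm_sq_eq, EuclideanSpace.real_norm_sq_eq,
    ← Real.exp_nat_mul] at h2
  have h3 : ∀ k, ∑ i, w i * G i k = (Matrix.conjTranspose G).mulVec w k := fun k => by
    simp [Matrix.mulVec, dotProduct, mul_comm]
  change ∑ k, (∑ i, w i * G i k) ^ 2 ≤ _
  simp_rw [h3]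
  rw [show 2 * r * spectralNorm₂ ξ = (2 : ℕ) * (r * spectralNorm₂ ξ) by push_cast; ring]
  exact h2

/-- The chord bound for the convex function `exp` on `[0, log 2]`. -/
theorem exp_two_mul_mul_le {ρ T r : ℝ} (hT : 0 < T) (hr : 0 ≤ r) (hrT : r ≤ T)
    (h : 2 * ρ * T ≤ Real.log 2) : Real.exp (2 * r * ρ) ≤ 1 + r / T := by
  have h1 := convexOn_exp.2 (Set.mem_univ (0 : ℝ)) (Set.mem_univ (Real.log 2))
    (show 0 ≤ 1 - r / T by rw [sub_nonneg, div_le_one hT]; exact hrT) (show 0 ≤ r / T by positivity)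
    (by ring)
  simp only [smul_eq_mul, mul_zero, zero_add, Real.exp_zero, mul_one,
    Real.exp_log (show (0 : ℝ) < 2 by norm_num)] at h1
  have h2 : 2 * r * ρ = r / T * (2 * ρ * T) := by field_simp
  calc Real.exp (2 * r * ρ) ≤ Real.exp (r / T * Real.log 2) := by rw [h2]; gcongr
    _ ≤ _ := by linarith

/-- The second moment matrix `∫₀ᵀ e^{rξ} (e^{rξ})ᵀ dr` of the particle system at time `T`, with the
integration variable reversed, `r = T - s`. -/
noncomputable def gramian (ξ : Matrix (Fin n) (Fin n) ℝ) (T : ℝ) : Matrix (Fin n) (Fin n) ℝ :=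
  Matrix.of fun i j => ∫ s in 0..T,
    ∑ k, propagator ξ i k (T - s) * propagator ξ j k (T - s)

/-- Off the diagonal, the integrand `∑ₖ (e^{rξ})ᵢₖ (e^{rξ})ⱼₖ` is at least its terms `k = i` and
`k = j`, which are bounded below by `r ξⱼᵢ` and `r ξᵢⱼ`. -/
theorem le_gramian (hξ : ∀ i j, 0 ≤ ξ i j) {T : ℝ} (hT : 0 ≤ T) {i j : Fin n} (hij : i ≠ j) :
    T ^ 2 / 2 * (ξ i j + ξ j i) ≤ gramian ξ T i j := by
  have h1 : ∫ s in 0..T, (T - s) * (ξ i j + ξ j i) = T ^ 2 / 2 * (ξ i j + ξ j i) := by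
    rw [intervalIntegral.integral_mul_const, intervalIntegral.integral_sub (by simp) (by simp)]
    simp only [intervalIntegral.integral_const, integral_id, smul_eq_mul]
    ring
  rw [← h1]
  refine intervalIntegral.integral_mono_on hT (Continuous.intervalIntegrable (by fun_prop) _ _)
    (Continuous.intervalIntegrable (by fun_prop) _ _) fun s hs => ?_
  have hr : 0 ≤ T - s := sub_nonneg.2 hs.2
  generalize T - s = r at *
  let G : Matrix (Fin n) (Fin n) ℝ := fun i j => propagator ξ i j r
  have hG : ∀ i j, (1 : Matrix (Fin n) (Fin n) ℝ) i j + r * ξ i j ≤ G i j :=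
    one_add_mul_le_propagator hξ hr
  have hG1 : ∀ i, 1 ≤ G i i := fun i => by
    have := hG i i; rw [Matrix.one_apply_eq] at this; linarith [mul_nonneg hr (hξ i i)]
  have hG2 : ∀ {i j}, i ≠ j → r * ξ i j ≤ G i j := fun {i j} h => by
    have := hG i j; rw [Matrix.one_apply_ne h] at this; linarith
  have hG0 : ∀ i j, 0 ≤ G i j := fun i j => by
    rcases eq_or_ne i j with rfl | h
    · linarith [hG1 i]
    · exact (mul_nonneg hr (hξ i j)).trans (hG2 h)
  change _ ≤ ∑ k, G i k * G j k
  calc r * (ξ i j + ξ j i) = 1 * (r * ξ j i) + r * ξ i j * 1 := by ring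
    _ ≤ G i i * G j i + G i j * G j j := by
        gcongr
        · exact mul_nonneg hr (hξ j i)
        · exact hG0 i i
        · exact hG1 i
        · exact hG2 hij.symm
        · exact hG0 i j
        · exact hG2 hij
        · exact hG1 j
    _ = ∑ k ∈ {i, j}, G i k * G j k := by rw [Finset.sum_pair hij]
    _ ≤ ∑ k, G i k * G j k :=
        Finset.sum_le_univ_sum_of_nonneg fun k => mul_nonneg (hG0 _ _) (hG0 _ _)

/-- The integrand is at most `‖e^{rξ}‖² |w|² ≤ (1 + r / T) |w|²`, and `1 + r / T` averages to
`3 / 2`. -/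
theorem sum_mul_gramian_le {T : ℝ} (hT : 0 < T) (h : 2 * spectralNorm₂ ξ * T ≤ Real.log 2)
    (w : Fin n → ℝ) : ∑ i, ∑ j, w i * w j * gramian ξ T i j ≤ 3 / 2 * T * ∑ i, w i ^ 2 := by
  have h1 : ∑ i, ∑ j, w i * w j * gramian ξ T i j
      = ∫ s in 0..T, ∑ k, (∑ i, w i * propagator ξ i k (T - s)) ^ 2 := by
    have h2 : ∀ s, ∑ k, (∑ i, w i * propagator ξ i k (T - s)) ^ 2
        = ∑ i, ∑ j, w i * w j * ∑ k, propagator ξ i k (T - s)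
          * propagator ξ j k (T - s) := fun s => by
      simp_rw [sq_sum_mul_eq, Finset.mul_sum]
      rw [Finset.sum_comm]
      exact Finset.sum_congr rfl fun i _ => Finset.sum_comm
    simp_rw [h2]
    rw [intervalIntegral.integral_finsetSum fun i _ =>
      Continuous.intervalIntegrable (by fun_prop) _ _]
    refine Finset.sum_congr rfl fun i _ => ?_
    rw [intervalIntegral.integral_finsetSum fun i _ =>
      Continuous.intervalIntegrable (by fun_prop) _ _]
    refine Finset.sum_congr rfl fun j _ => ?_
    rw [intervalIntegral.integral_const_mul]
    rfl
  have h3 : ∫ s in 0..T, (1 + (T - s) / T) * ∑ i, w i ^ 2 = 3 / 2 * T * ∑ i, w i ^ 2 := by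
    rw [intervalIntegral.integral_mul_const, intervalIntegral.integral_add (by simp)
      (Continuous.intervalIntegrable (by fun_prop) _ _), intervalIntegral.integral_div,
      intervalIntegral.integral_sub (by simp) (by simp)]
    congr 1
    simp; field_simp; ring
  rw [h1, ← h3]
  refine intervalIntegral.integral_mono_on hT.le (Continuous.intervalIntegrable (by fun_prop) _ _)
    (Continuous.intervalIntegrable (by fun_prop) _ _) fun s hs => ?_
  have hr : 0 ≤ T - s := sub_nonneg.2 hs.2
  refine (sum_sq_mul_propagator_le ξ hr w).trans ?_
  gcongr
  exact exp_two_mul_mul_le hT hr (by linarith [hs.1]) h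

end MatrixExponential

/-! ### The particle system and its independent projection -/

section Particles

variable {n : ℕ} {ξ : Matrix (Fin n) (Fin n) ℝ}

/-- Variation of constants for `x = ∫ ξ x + b`, with the noise integrated by parts so that `b` need
only be continuous. The proof differentiates `s ↦ e^{(T-s)ξ} D s`, where `D = x - b` is the
differentiable part of the solution. -/
theorem linear_volterra_eq_sum {x b : Fin n → ℝ → ℝ} (hx : ∀ i, Continuous (x i))
    (hb : ∀ i, Continuous (b i))
    (hxb : ∀ i t, 0 ≤ t → x i t = (∫ s in 0..t, ∑ j, ξ i j * x j s) + b i t)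
    {T : ℝ} (hT : 0 ≤ T) (i : Fin n) :
    x i T = ∑ j, (propagator ξ i j (T - T) * b j T
      - ∫ s in 0..T, -(∑ k, propagator ξ i k (T - s) * ξ k j) * b j s) := by
  let D : Fin n → ℝ → ℝ := fun j t => ∫ s in 0..t, ∑ l, ξ j l * x l s
  have hD : ∀ j t, HasDerivAt (D j) (∑ l, ξ j l * x l t) t := fun j t =>
    ((show Continuous fun s => ∑ l, ξ j l * x l s by
      fun_prop).integral_hasStrictDerivAt 0 t).hasDerivAt
  have hG : ∀ j t, HasDerivAt (fun s => propagator ξ i j (T - s))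
      (-(∑ k, propagator ξ i k (T - t) * ξ k j)) t := fun j t =>
    (hasDerivAt_propagator ξ i j (T - t)).comp_const_sub T t
  have hd : ∀ t ∈ Set.uIcc 0 T, HasDerivAt (fun s => ∑ j, propagator ξ i j (T - s) * D j s)
      (∑ j, (∑ k, propagator ξ i k (T - t) * ξ k j) * b j t) t := fun t ht => by
    rw [Set.uIcc_of_le hT] at ht
    refine (HasDerivAt.fun_sum fun j _ => (hG j t).mul (hD j t)).congr_deriv ?_
    have h1 : ∀ j, b j t = x j t - D j t := fun j => by rw [hxb j t ht.1]; simp [D]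
    have h2 : ∑ j, propagator ξ i j (T - t) * ∑ l, ξ j l * x l t
        = ∑ j, (∑ k, propagator ξ i k (T - t) * ξ k j) * x j t := by
      simp_rw [Finset.mul_sum, Finset.sum_mul]
      rw [Finset.sum_comm]
      exact Finset.sum_congr rfl fun _ _ => Finset.sum_congr rfl fun _ _ => by ring
    rw [Finset.sum_add_distrib, h2, ← Finset.sum_add_distrib]
    exact Finset.sum_congr rfl fun j _ => by rw [h1]; ring
  have h := intervalIntegral.integral_eq_sub_of_hasDerivAt hd
    (Continuous.intervalIntegrable (by fun_prop) _ _)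
  have h1 : ∀ u : Fin n → ℝ, ∑ j, propagator ξ i j 0 * u j = u i := fun u => by
    simp [propagator_zero, Matrix.one_apply]
  have h0 : ∀ j, D j 0 = 0 := fun j => intervalIntegral.integral_same
  simp only [sub_self, h1, h0, mul_zero, Finset.sum_const_zero, sub_zero] at h
  rw [intervalIntegral.integral_finsetSum fun j _ =>
    Continuous.intervalIntegrable (by fun_prop) _ _] at h
  simp only [sub_self, neg_mul, intervalIntegral.integral_neg, sub_neg_eq_add]
  rw [Finset.sum_add_distrib, h1, h, hxb i T hT, add_comm]

theorem sum_erase_eq_sum_of_diag_eq_zero (hξ : ∀ i, ξ i i = 0) (i : Fin n) (x : Fin n → ℝ) :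
    ∑ j ∈ Finset.univ.erase i, ξ i j * x j = ∑ j, ξ i j * x j :=
  Finset.sum_erase _ (by rw [hξ, zero_mul])

variable {Ω : Type*} [MeasurableSpace Ω] {P : Measure Ω}

/-- Along almost every path, the particle system solves a linear ODE forced by the noise, so it is
the Wiener integral `∫₀ᵀ e^{(T-s)ξ} dW_s` against any continuous version `W` of the noise. -/
theorem IsLinearParticleSystem.ae_eq_sum_wienerIntegral {X B : Fin n → ℝ≥0 → Ω → ℝ}
    (hX : IsLinearParticleSystem ξ X B P) (hξ : ∀ i, ξ i i = 0) {W : Fin n → ℝ → Ω → ℝ}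
    (hWB : ∀ᵐ ω ∂P, ∀ i t, W i t ω = B i t.toNNReal ω)
    (hW : ∀ i, IsContinuousBrownianVersion (W i) P) (T : ℝ≥0) :
    ∀ᵐ ω ∂P, ∀ i, X i T ω = ∑ j, wienerIntegral (fun s => propagator ξ i j (T - s))
      (fun s => -(∑ k, propagator ξ i k (T - s) * ξ k j)) (W j) T ω := by
  filter_upwards [hWB, hX.continuous_paths, hX.init, hX.equation] with ω hω hc h0 heq i
  have h := linear_volterra_eq_sum (ξ := ξ) (x := fun i t => X i t.toNNReal ω)
    (b := fun i t => W i t ω) (fun i => (hc i).comp continuous_real_toNNReal)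
    (fun i => (hW i).continuous ω) (fun i t ht => ?_) T.coe_nonneg i
  · simpa [wienerIntegral] using h
  · have := heq i t.toNNReal
    simp only [h0, zero_add, sum_erase_eq_sum_of_diag_eq_zero hξ, Real.coe_toNNReal t ht,
      ← hω] at this
    exact this

variable [IsProbabilityMeasure P]

theorem IsBrownianFamily.exists_continuousVersion {B : Fin n → ℝ≥0 → Ω → ℝ}
    (hB : IsBrownianFamily B P) :
    ∃ W : Fin n → ℝ → Ω → ℝ, (∀ i, IsContinuousBrownianVersion (W i) P) ∧
      (∀ᵐ ω ∂P, ∀ i t, W i t ω = B i t.toNNReal ω) ∧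
      ∀ i j s u, 0 ≤ s → 0 ≤ u →
        ∫ ω, W i s ω * W j u ω ∂P = (1 : Matrix (Fin n) (Fin n) ℝ) i j * min s u := by
  choose W hW hWB using fun i => (hB.brownian i).exists_continuousVersion
  refine ⟨W, hW, ae_all_iff.2 hWB, fun i j s u hs hu => ?_⟩
  have h1 : ∫ ω, W i s ω * W j u ω ∂P = ∫ ω, (B i s.toNNReal * B j u.toNNReal) ω ∂P := by
    refine integral_congr_ae ?_
    filter_upwards [hWB i, hWB j] with ω hi hj
    rw [hi, hj]; rfl
  have hL2 : ∀ i t, MemLp (B i t) 2 P := fun i t =>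
    ((hB.brownian i).hasLaw_eval t).hasGaussianLaw.memLp_two
  rw [h1]
  rcases eq_or_ne i j with rfl | hij
  · have h := (hB.brownian i).covariance_eval s.toNNReal u.toNNReal
    rw [covariance_eq_sub (hL2 _ _) (hL2 _ _), (hB.brownian i).integral_eval, zero_mul,
      sub_zero] at h
    rw [h, Matrix.one_apply_eq, one_mul, NNReal.coe_min, Real.coe_toNNReal s hs,
      Real.coe_toNNReal u hu]
  · have hind : IndepFun (B i s.toNNReal) (B j u.toNNReal) P :=
      (hB.indep.indepFun hij).comp (measurable_pi_apply s.toNNReal)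
        (measurable_pi_apply u.toNNReal)
    rw [hind.integral_mul_eq_mul_integral (hL2 _ _).1 (hL2 _ _).1,
      (hB.brownian i).integral_eval, zero_mul, Matrix.one_apply_ne hij, zero_mul]

/-- The second moment matrix of the particle system, from the Wiener isometry applied to
`X_T = ∫₀ᵀ e^{(T-s)ξ} dB_s`. -/
theorem IsLinearParticleSystem.secondMoment_eq_gramian {X B : Fin n → ℝ≥0 → Ω → ℝ}
    (hX : IsLinearParticleSystem ξ X B P) (hξ : ∀ i, ξ i i = 0) (T : ℝ≥0) (i j : Fin n) :
    Integrable (fun ω => X i T ω * X j T ω) P ∧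
      ∫ ω, X i T ω * X j T ω ∂P = gramian ξ T i j := by
  obtain ⟨W, hW, hWB, hcov⟩ := hX.noise.exists_continuousVersion
  let K : Fin n → Fin n → ℝ → ℝ := fun i j s => propagator ξ i j (T - s)
  let K' : Fin n → Fin n → ℝ → ℝ := fun i j s => -(∑ k, propagator ξ i k (T - s) * ξ k j)
  have hK : ∀ i j s, HasDerivAt (K i j) (K' i j s) s := fun i j s =>
    (hasDerivAt_propagator ξ i j (T - s)).comp_const_sub (T : ℝ) s
  have hK' : ∀ i j, Continuous (K' i j) := fun i j => by fun_prop
  let I : Fin n → Fin n → Ω → ℝ := fun i j => wienerIntegral (K i j) (K' i j) (W j) T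
  have hI : ∀ i j, MemLp (I i j) 2 P := fun i j =>
    memLp_wienerIntegral (hW j) (hK' i j) T.coe_nonneg
  have hae : (fun ω => X i T ω * X j T ω) =ᵐ[P] fun ω => ∑ k, ∑ l, I i k ω * I j l ω := by
    filter_upwards [hX.ae_eq_sum_wienerIntegral hξ hWB hW T] with ω h
    rw [h i, h j, Finset.sum_mul_sum]
  have hint : ∀ k l, Integrable (fun ω => I i k ω * I j l ω) P := fun k l =>
    (hI i k).integrable_fun_mul (hI j l)
  refine ⟨(integrable_congr hae).2 (integrable_finsetSum _ fun k _ =>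
    integrable_finsetSum _ fun l _ => hint k l), ?_⟩
  rw [integral_congr_ae hae, integral_finsetSum _ fun k _ =>
    integrable_finsetSum _ fun l _ => hint k l, gramian, Matrix.of_apply,
    intervalIntegral.integral_finsetSum fun k _ =>
      Continuous.intervalIntegrable (by fun_prop) _ _]
  refine Finset.sum_congr rfl fun k _ => ?_
  rw [integral_finsetSum _ fun l _ => hint k l]
  have h : ∀ l, ∫ ω, I i k ω * I j l ω ∂P
      = (1 : Matrix (Fin n) (Fin n) ℝ) k l * ∫ s in 0..T, K i k s * K j l s := fun l =>
    integral_wienerIntegral_mul_wienerIntegral (hW k) (hW l) (hcov k l) (hK i k) (hK' i k)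
      (hK j l) (hK' j l) T.coe_nonneg
  simp only [h, Matrix.one_apply, ite_mul, one_mul, zero_mul, Finset.sum_ite_eq, Finset.mem_univ,
    if_true]
  rfl

/-- The mean solves the linear equation `m = ∫ ξ m`, hence vanishes by Grönwall's inequality. -/
theorem IsIndependentProjection.integral_eq_zero {Y B : Fin n → ℝ≥0 → Ω → ℝ}
    (hY : IsIndependentProjection ξ Y B P) (hξ : ∀ i, ξ i i = 0) (i : Fin n) (t : ℝ≥0) :
    ∫ ω, Y i t ω ∂P = 0 := by
  let m : ℝ → Fin n → ℝ := fun s i => ∫ ω, Y i s.toNNReal ω ∂P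
  let D : ℝ → Fin n → ℝ := fun s i => ∫ r in 0..s, ∑ j, ξ i j * m r j
  -- The time integral of the drift is deterministic, so only the noise is averaged.
  have hmD : ∀ s, 0 ≤ s → m s = D s := fun s hs => by
    ext i
    have h : Y i s.toNNReal =ᵐ[P] fun ω => D s i + B i s.toNNReal ω := by
      filter_upwards [hY.init, hY.equation] with ω h0 heq
      have := heq i s.toNNReal
      simp only [h0, zero_add, sum_erase_eq_sum_of_diag_eq_zero hξ, Real.coe_toNNReal s hs] at this
      exact this
    simp only [m]
    rw [integral_congr_ae h, integral_add (integrable_const _)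
      ((hY.noise.brownian i).integrable_eval _), (hY.noise.brownian i).integral_eval]
    simp
  have hDint : ∀ i (s : ℝ), 0 ≤ s →
      IntervalIntegrable (fun r => ∑ j, ξ i j * m r j) volume 0 s := fun i s hs => by
    have := hY.drift_integrable i s.toNNReal
    simp only [sum_erase_eq_sum_of_diag_eq_zero hξ, Real.coe_toNNReal s hs] at this
    exact this
  have ht := t.coe_nonneg
  -- The drift is only assumed integrable. Its primitive `D` is continuous and equals the mean, so
  -- the drift is continuous after all. Working on `[0, t + 1]` gives room for derivatives up to
  -- time `t`.
  have hDc : ContinuousOn D (Set.Icc 0 (t + 1)) := by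
    refine continuousOn_pi.2 fun i => ?_
    have := intervalIntegral.continuousOn_primitive_interval' (hDint i (t + 1) (by positivity))
      (Set.left_mem_uIcc)
    rwa [Set.uIcc_of_le (by positivity)] at this
  have hmc : ContinuousOn m (Set.Icc 0 (t + 1)) := hDc.congr fun s hs => hmD s hs.1
  let A : (Fin n → ℝ) →L[ℝ] (Fin n → ℝ) := (Matrix.mulVecLin ξ).toContinuousLinearMap
  have hA : ∀ u i, A u i = ∑ j, ξ i j * u j := fun u i => rfl
  have hderiv : ∀ s ∈ Set.Ico (0 : ℝ) t, HasDerivWithinAt D (A (D s)) (Set.Ici s) s := by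
    intro s hs
    refine hasDerivWithinAt_pi.2 fun i => ?_
    rw [hA, ← hmD s hs.1]
    have hci : ContinuousOn (fun r => ∑ j, ξ i j * m r j) (Set.Icc 0 (t + 1)) := by
      have : (fun r => ∑ j, ξ i j * m r j) = fun r => A (m r) i := rfl
      rw [this]
      exact ((continuous_apply i).comp A.continuous).comp_continuousOn hmc
    have hnhds : Set.Icc (0 : ℝ) (t + 1) ∈ nhdsWithin s (Set.Ioi s) :=
      Filter.mem_of_superset (Ioo_mem_nhdsGT (show s < t + 1 by linarith [hs.2]))
        fun r hr => ⟨hs.1.trans hr.1.le, hr.2.le⟩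
    refine intervalIntegral.integral_hasDerivWithinAt_right (hDint i s hs.1)
      (s := Set.Ici s) (t := Set.Ioi s) ?_ ?_
    · exact ⟨_, hnhds, hci.aestronglyMeasurable measurableSet_Icc⟩
    · exact (hci s ⟨hs.1, by linarith [hs.2]⟩).mono_of_mem_nhdsWithin hnhds
  have h0 := eq_zero_of_abs_deriv_le_mul_abs_self_of_eq_zero_right
    (hDc.mono (Set.Icc_subset_Icc_right (by linarith))) hderiv
    (by ext i; exact intervalIntegral.integral_same) (K := ‖A‖) (fun s _ => A.le_opNorm _)
    t ⟨ht, le_rfl⟩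
  have := congrFun (hmD t ht) i
  rw [h0] at this
  simpa [m] using this

/-- Since the means vanish, the independent projection is its own driving Brownian motion. -/
theorem IsIndependentProjection.marginalLaw_eq {Y B : Fin n → ℝ≥0 → Ω → ℝ}
    (hY : IsIndependentProjection ξ Y B P) (hξ : ∀ i, ξ i i = 0) (v : Finset (Fin n)) (t : ℝ≥0) :
    marginalLaw P Y v t = Measure.pi fun _ : v => gaussianReal 0 t := by
  have hYB : ∀ᵐ ω ∂P, ∀ i, Y i t ω = B i t ω := by
    filter_upwards [hY.init, hY.equation] with ω h0 heq i
    rw [heq i t, h0]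
    simp [hY.integral_eq_zero hξ]
  have hlaw := fun i => (hY.noise.brownian i).hasLaw_eval t
  have hind : iIndepFun (fun (i : v) ω => B i t ω) P :=
    (hY.noise.indep.precomp Subtype.val_injective).comp (fun _ x => x t)
      fun _ => measurable_pi_apply t
  have h := (iIndepFun_iff_map_fun_eq_pi_map fun i : v => (hlaw i).aemeasurable).1 hind
  rw [marginalLaw, Measure.map_congr (g := fun ω (i : v) => B i t ω)
    (hYB.mono fun ω h => funext fun i => h i), h]
  exact congrArg _ (funext fun i => (hlaw i).map_eq)

end Particles

theorem proposition2p17 {n : ℕ} (ξ : Matrix (Fin n) (Fin n) ℝ)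
    (hξ_nonneg : ∀ i j, 0 ≤ ξ i j) (hξ_diag : ∀ i, ξ i i = 0)
    {Ω Ω' : Type*} [MeasurableSpace Ω] [MeasurableSpace Ω']
    (P : Measure Ω) [IsProbabilityMeasure P] (P' : Measure Ω') [IsProbabilityMeasure P']
    (X B : Fin n → ℝ≥0 → Ω → ℝ) (hX : IsLinearParticleSystem ξ X B P)
    (Y B' : Fin n → ℝ≥0 → Ω' → ℝ) (hY : IsIndependentProjection ξ Y B' P')
    (T : ℝ≥0) (hT : 2 * spectralNorm₂ ξ * (T : ℝ) ≤ Real.log 2) (v : Finset (Fin n)) :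
    ENNReal.ofReal ((T : ℝ) ^ 2 / 12 * ∑ i ∈ v, ∑ j ∈ v, ξ i j ^ 2)
      ≤ InformationTheory.klDiv (marginalLaw P X v T) (marginalLaw P' Y v T) := by
  rcases eq_or_ne T 0 with rfl | hT0
  · simp
  have hTpos : 0 < T := pos_iff_ne_zero.2 hT0
  have hTpos' : (0 : ℝ) < T := hTpos
  have hXm : AEMeasurable (fun ω (i : v) => X i T ω) P :=
    aemeasurable_pi_lambda _ fun i => hX.aemeasurable i T
  have : IsProbabilityMeasure (marginalLaw P X v T) := Measure.isProbabilityMeasure_map hXm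
  let C : Matrix v v ℝ := Matrix.of fun i j => gramian ξ T i j
  rw [hY.marginalLaw_eq hξ_diag]
  have hmeas : ∀ i j : v, AEStronglyMeasurable (fun x : v → ℝ => x i * x j)
      (P.map fun ω (i : v) => X i T ω) := fun i j =>
    Measurable.aestronglyMeasurable (by fun_prop)
  have hmain := le_klDiv_pi_gaussianReal_of_secondMoment (μ := marginalLaw P X v T) hTpos (C := C)
    (fun i j => (integrable_map_measure (hmeas i j) hXm).2
      (hX.secondMoment_eq_gramian hξ_diag T i j).1)
    (fun i j => (integral_map hXm (hmeas i j)).trans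
      (hX.secondMoment_eq_gramian hξ_diag T i j).2)
    (fun w => ?_)
  · refine le_trans (ENNReal.ofReal_le_ofReal ?_) hmain
    have hCle : ∀ i j : v,
        T / 2 * (ξ i j + ξ j i) ≤ C i j / T - (1 : Matrix v v ℝ) i j ∨ i = j := by
      intro i j
      rcases eq_or_ne i j with h | h
      · exact .inr h
      · left
        rw [Matrix.one_apply_ne h, sub_zero, le_div_iff₀ hTpos']
        have := le_gramian hξ_nonneg hTpos'.le (fun h' => h (Subtype.ext h'))
        refine le_trans (le_of_eq ?_) this
        ring
    have hsq : ∀ i j : v, T ^ 2 / 4 * (ξ i j ^ 2 + ξ j i ^ 2)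
        ≤ (C i j / T - (1 : Matrix v v ℝ) i j) ^ 2 := by
      intro i j
      rcases hCle i j with h | rfl
      · have h1 := hξ_nonneg i j
        have h2 := hξ_nonneg j i
        refine le_trans ?_ (pow_le_pow_left₀ (by positivity) h 2)
        have : 0 ≤ (T : ℝ) ^ 2 / 2 * (ξ i j * ξ j i) := by positivity
        linarith
      -- On the diagonal `ξ` vanishes, and the left side is zero.
      · simp only [hξ_diag]
        nlinarith [sq_nonneg (C i i / T - (1 : Matrix v v ℝ) i i)]
    have hsum := Finset.sum_le_sum fun (i : v) (_ : i ∈ Finset.univ) =>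
      Finset.sum_le_sum fun (j : v) (_ : j ∈ Finset.univ) => hsq i j
    have hcomm : ∑ i : v, ∑ j : v, ξ j i ^ 2 = ∑ i : v, ∑ j : v, ξ i j ^ 2 := Finset.sum_comm
    simp_rw [← Finset.mul_sum, Finset.sum_add_distrib] at hsum
    rw [hcomm] at hsum
    have hv : ∑ i ∈ v, ∑ j ∈ v, ξ i j ^ 2 = ∑ i : v, ∑ j : v, ξ i j ^ 2 := by
      rw [← Finset.sum_coe_sort v]
      exact Finset.sum_congr rfl fun i _ => (Finset.sum_coe_sort v fun j => ξ i j ^ 2).symm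
    rw [hv]
    linarith
  -- The quadratic form bound for the principal submatrix: extend `w` by zero.
  · let w' : Fin n → ℝ := fun i => if h : i ∈ v then w ⟨i, h⟩ else 0
    have hext : ∀ f : Fin n → ℝ, (∀ i ∉ v, f i = 0) → ∑ i, f i = ∑ i : v, f i := fun f hf => by
      rw [Finset.sum_coe_sort v f]
      exact (Finset.sum_subset (Finset.subset_univ v) fun i _ hi => hf i hi).symm
    have hw'0 : ∀ i ∉ v, w' i = 0 := fun i hi => dif_neg hi
    have hw' : ∀ i : v, w' i = w i := fun i => dif_pos i.2
    have h := sum_mul_gramian_le hTpos' hT w'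
    rw [hext _ fun i hi => by simp [hw'0 i hi], hext _ fun i hi => by simp [hw'0 i hi]] at h
    simp_rw [hw'] at h
    refine le_trans (le_of_eq ?_) h
    refine Finset.sum_congr rfl fun i _ => ?_
    rw [hext _ fun j hj => by simp [hw'0 j hj]]
    simp_rw [hw']
    rfl
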